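/- **Theorem.** Let $A$ be a set with at least two elements. Two functions $f, g \colon A^n \to A$ are *equivalent*, $f \equiv g$, if there is a permutation $\sigma$ of $\{1,\dots,n\}$ such that $f(a_1,\dots,a_n) = g(a_{\sigma(1)},\dots,a_{\sigma(n)})$ for all $(a_1,\dots,a_n) \in A^n$. For $n \ge 2$, $f \colon A^n \to A$ and a two-element subset $I$ of $\{1,\dots,n\}$, the *identification minor* $f_I \colon A^{n-1} \to A$ is defined by $$f_I(a_1,\dots,a_{n-1}) = f(a_1,\dots,a_{\max I - 1}, a_{\min I}, a_{\max I},\dots,a_{n-1}).$$ The *deck* of $f$ is the multiset of the equivalence classes $f_I/{\equiv}$, where $I$ ranges over all two-element subsets of $\{1,\dots,n\}$. The function $f$ is *reconstructible* if every $g \colon A^n \to A$ with the same deck as $f$ is equivalent to $f$; a class of functions is *reconstructible* if all its members are. Let $G$ be a finite field of order $q$. The class of all functions $f \colon G^n \to G$ of arity $n \ge \max(q,3)+1$ that are affine, i.e. of the form $f(x_1,\dots,x_n) = a_1x_1 + \dots + a_nx_n + c$ with $a_1,\dots,a_n,c \in G$, is reconstructible. -/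

import Mathlib

namespace FunRec

/-- A function of several arguments from `A` to `B` of arity `n`. -/
abbrev NFun (A B : Type*) (n : ℕ) := (Fin n → A) → B

/-- Functions of several arguments from `A` to `B`, of any arity at least one:
the pair `⟨m, f⟩` is a function `f` of arity `m + 1`. -/
abbrev SomeFun (A B : Type*) := Σ m : ℕ, NFun A B (m + 1)

/-- The arity of a function of several arguments. -/
def SomeFun.arity {A B : Type*} (f : SomeFun A B) : ℕ := f.1 + 1

/-- Two functions are equivalent if they differ by a permutation of their arguments. -/
def Equivalent {A B : Type*} {n : ℕ} (f g : NFun A B n) : Prop :=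
  ∃ σ : Equiv.Perm (Fin n), ∀ a : Fin n → A, f a = g (fun i => a (σ i))

theorem equivalent_refl {A B : Type*} {n : ℕ} (f : NFun A B n) : Equivalent f f :=
  ⟨1, fun _ => rfl⟩

theorem equivalent_symm {A B : Type*} {n : ℕ} {f g : NFun A B n}
    (h : Equivalent f g) : Equivalent g f := by
  obtain ⟨σ, hσ⟩ := h
  refine ⟨σ⁻¹, fun a => ?_⟩
  rw [hσ]
  simp

theorem equivalent_trans {A B : Type*} {n : ℕ} {f g k : NFun A B n}
    (h₁ : Equivalent f g) (h₂ : Equivalent g k) : Equivalent f k := by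
  obtain ⟨σ, hσ⟩ := h₁
  obtain ⟨τ, hτ⟩ := h₂
  refine ⟨σ * τ, fun a => ?_⟩
  rw [hσ, hτ]
  rfl

/-- Equivalence of `n`-ary functions, as a setoid. -/
def equivSetoid (A B : Type*) (n : ℕ) : Setoid (NFun A B n) where
  r := Equivalent
  iseqv := ⟨equivalent_refl, equivalent_symm, equivalent_trans⟩

/-- The two-element subsets `I` of `Fin n`, each encoded as the pair `(min I, max I)`. -/
abbrev Couple (n : ℕ) := {p : Fin n × Fin n // p.1 < p.2}

/-- The identification minor `f_I`: the argument at position `max I` of `f` is filled with the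
value at position `min I`, and the other positions are filled, in order, with the entries of `a`. -/
def identMinor {A B : Type*} {m : ℕ} (f : NFun A B (m + 1)) (I : Couple (m + 1)) :
    NFun A B m :=
  fun a => f (Fin.insertNth (α := fun _ => A) I.1.2
    (a (I.1.1.castPred (Fin.ne_last_of_lt I.2))) a)

/-- The deck of `f`: the multiset of the equivalence classes of all identification minors of `f`,
one for each couple. (A unary function has no couples, and its deck is empty.) -/
def deck {A B : Type*} {m : ℕ} (f : NFun A B (m + 1)) :
    Multiset (Quotient (equivSetoid A B m)) :=
  (Finset.univ : Finset (Couple (m + 1))).val.map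
    fun I => Quotient.mk (equivSetoid A B m) (identMinor f I)

/-- `g` is a reconstruction of `f` if it has the same arity and the same deck. -/
def IsReconstruction {A B : Type*} {m : ℕ} (g f : NFun A B (m + 1)) : Prop :=
  deck f = deck g

/-- A function is reconstructible if it is equivalent to all of its reconstructions. -/
def Reconstructible {A B : Type*} {m : ℕ} (f : NFun A B (m + 1)) : Prop :=
  ∀ g : NFun A B (m + 1), IsReconstruction g f → Equivalent f g

/-- A class of functions is reconstructible if all of its members are. -/
def ReconstructibleClass {A B : Type*} (C : Set (SomeFun A B)) : Prop :=
  ∀ f ∈ C, Reconstructible f.2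

/-- Affine functions `a₁ x₁ + ⋯ + aₙ xₙ + c`. -/
def IsAffine {G : Type*} [Semiring G] {n : ℕ} (f : NFun G G n) : Prop :=
  ∃ (a : Fin n → G) (c : G), ∀ x : Fin n → G, f x = ∑ i, a i * x i + c

end FunRec

/-! Let `f` be affine and `g` have the same deck. Every minor of `g` is equivalent to one of `f`,
hence affine, with constant term `g 0`. So `g - g 0` is linear on each hyperplane `x i = x j`. As `n
≥ 4`, these linear forms glue to one (`exists_linear_of_forall_hyperplane`); as `n > q`, the
hyperplanes cover `G^n` by pigeonhole. Thus `g` is affine.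

An affine function is given, up to equivalence, by its constant term and its multiset `M` of
coefficients. A minor replaces two coefficients by their sum, so the deck determines `C(n-1, 2) • M
+ pairSums M`; the values at constant tuples give the constant term and the sum of `M`. These data
determine `M` (`eq_of_nsmul_add_pairSums_eq`): multiples of `M` outweigh the pair sums, so two
candidates differ in at most one element, which the sum fixes. -/

namespace FunRec

/-! ### Multisets and their pair sums -/

/-- The multiset of the sums of the two-element submultisets of `M`. -/
def pairSums {G : Type*} [AddCommMonoid G] (M : Multiset G) : Multiset G :=
  (M.powersetCard 2).map Multiset.sum

theorem card_pairSums {G : Type*} [AddCommMonoid G] (M : Multiset G) :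
    (pairSums M).card = M.card.choose 2 := by
  simp [pairSums]

theorem pairSums_mono {G : Type*} [AddCommMonoid G] {M N : Multiset G} (h : M ≤ N) :
    pairSums M ≤ pairSums N :=
  Multiset.map_le_map (Multiset.powersetCard_mono 2 h)

theorem two_mul_choose_two (n : ℕ) : (2 * (n.choose 2 : ℤ)) = n * (n - 1) := by
  induction n with
  | zero => simp
  | succ n ih => rw [Nat.choose_succ_succ' n 1]; push_cast; rw [Nat.choose_one_right]; linarith

theorem le_one_of_choose_mul_add_le {n k : ℕ} (hn : 4 ≤ n) (hk : k ≤ n)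
    (h : (n - 1).choose 2 * k + (n - k).choose 2 ≤ n.choose 2) : k ≤ 1 := by
  by_contra! h2
  have e1 := two_mul_choose_two n
  have e2 := two_mul_choose_two (n - 1)
  have e3 := two_mul_choose_two (n - k)
  rw [Nat.cast_sub (by omega)] at e2
  rw [Nat.cast_sub hk] at e3
  zify at h hn hk h2
  push_cast at *
  have key : ((n : ℤ) - 1) * (n - 2) * k + (n - k) * (n - k - 1) ≤ n * (n - 1) := by
    nlinarith
  -- Twice the difference of the two sides of `h`. The second factor is positive because `n * (n -
  -- 5) ≥ -4` for `n ≥ 4`, and `k ≥ 2`.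
  have key2 : 0 < (k : ℤ) * (n * (n - 5) + 3 + k) := by
    apply mul_pos (by linarith)
    nlinarith
  nlinarith

/-- A multiset with at least four elements of an abelian group is determined by its sum and
the multiset `C(n-1, 2) • M + pairSums M`. -/
theorem eq_of_nsmul_add_pairSums_eq {G : Type*} [AddCommGroup G] {M M' : Multiset G}
    (hM : 4 ≤ M.card) (hcard : M.card = M'.card) (hsum : M.sum = M'.sum)
    (h : (M.card - 1).choose 2 • M + pairSums M = (M.card - 1).choose 2 • M' + pairSums M') :
    M = M' := by
  classical
  obtain ⟨N, P, Q, hP, hQ, hd⟩ : ∃ N P Q : Multiset G, M = N + P ∧ M' = N + Q ∧ Disjoint P Q := by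
    refine ⟨M ∩ M', M - M', M' - M, ?_, ?_, ?_⟩
    · rw [add_comm, Multiset.sub_add_inter]
    · rw [add_comm, Multiset.inter_comm, Multiset.sub_add_inter]
    · rw [Multiset.disjoint_left]
      intro x hx hx'
      rw [Multiset.mem_sub] at hx hx'
      omega
  have hcM : M.card = N.card + P.card := by rw [hP, Multiset.card_add]
  have hcPQ : P.card = Q.card := by
    rw [hQ, Multiset.card_add] at hcard
    omega
  have hk : P.card ≤ 1 := by
    apply le_one_of_choose_mul_add_le hM (by omega)
    set c := (M.card - 1).choose 2
    have h1 : c • P + pairSums M = c • Q + pairSums M' := by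
      apply add_left_cancel (a := c • N)
      rw [← add_assoc, ← nsmul_add, ← hP, h, hQ, nsmul_add, add_assoc]
    -- Count only values lying in `P`: they contribute `c * P.card` on the left, and `Q` contributes
    -- nothing. Both families of pair sums contain those of `N`, so on the right they exceed the
    -- left by at most `C(n, 2) - C(n - k, 2)`, where `n = M.card` and `k = P.card`.
    have h2 := congrArg (fun S => (Multiset.filter (· ∈ P) S).card) h1
    have hPP : Multiset.filter (· ∈ P) P = P := Multiset.filter_eq_self.2 fun _ h => h
    have hPQ : Multiset.filter (· ∈ P) Q = 0 :=
      Multiset.filter_eq_nil.2 fun x hx hx' => Multiset.disjoint_left.1 hd hx' hx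
    simp only [Multiset.filter_add, Multiset.filter_nsmul, Multiset.card_add, hPP, hPQ,
      nsmul_zero, Multiset.card_zero, Multiset.card_nsmul] at h2
    have hNM : pairSums N ≤ pairSums M := pairSums_mono (hP ▸ Multiset.le_add_right _ _)
    have hNM' : pairSums N ≤ pairSums M' := pairSums_mono (hQ ▸ Multiset.le_add_right _ _)
    have h3 := Multiset.card_le_card (Multiset.filter_le_filter (· ∈ P) hNM)
    obtain ⟨R, hR⟩ := Multiset.le_iff_exists_add.1 hNM'
    have h4 : (pairSums M').card = (pairSums N).card + R.card := by rw [hR, Multiset.card_add]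
    have h5 : (Multiset.filter (· ∈ P) (pairSums M')).card ≤
        (Multiset.filter (· ∈ P) (pairSums N)).card + R.card := by
      rw [hR, Multiset.filter_add, Multiset.card_add]
      gcongr
      exact Multiset.filter_le _ _
    rw [card_pairSums, card_pairSums, ← hcard] at h4
    have h6 : M.card - P.card = N.card := by omega
    rw [h6]
    have h7 : c * P.card = P.card * c := mul_comm _ _
    lia
  have hPQ : P.sum = Q.sum := by simpa [hP, hQ] using hsum
  rcases Nat.le_one_iff_eq_zero_or_eq_one.1 hk with h0 | h1
  · rw [hP, hQ, Multiset.card_eq_zero.1 h0, Multiset.card_eq_zero.1 (hcPQ.symm.trans h0)]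
  · obtain ⟨x, hx⟩ := Multiset.card_eq_one.1 h1
    obtain ⟨y, hy⟩ := Multiset.card_eq_one.1 (hcPQ.symm.trans h1)
    rw [hx, hy] at hPQ
    simp only [Multiset.sum_singleton] at hPQ
    rw [hP, hQ, hx, hy, hPQ]

/-! ### Sums over couples -/

theorem sum_couple {N : Type*} [AddCommMonoid N] {n : ℕ} (F : Fin n → Fin n → N) :
    ∑ I : Couple n, F I.1.1 I.1.2 = ∑ i, ∑ j, if i < j then F i j else 0 := by
  rw [← Finset.sum_product', Finset.univ_product_univ, ← Finset.sum_filter,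
    Finset.sum_subtype (p := fun p : Fin n × Fin n => p.1 < p.2) _ (by simp)]

theorem sum_couple_add {N : Type*} [AddCommMonoid N] {n : ℕ} (h : Fin n → N) :
    ∑ I : Couple n, (h I.1.1 + h I.1.2) = (n - 1) • ∑ i, h i := by
  rw [Finset.sum_add_distrib, sum_couple fun i _ => h i, sum_couple fun _ j => h j,
    Finset.sum_comm (f := fun i j => if i < j then h j else 0), ← Finset.sum_add_distrib,
    Finset.smul_sum]
  refine Finset.sum_congr rfl fun i _ => ?_
  rw [← Finset.sum_add_distrib]
  have : ∀ j, ((if i < j then h i else 0) + if j < i then h i else 0) =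
      if j ≠ i then h i else 0 := by
    intro j
    rcases lt_trichotomy i j with hij | hij | hij
    · simp [hij, hij.not_gt, hij.ne']
    · simp [hij]
    · simp [hij, hij.not_gt, hij.ne]
  rw [Finset.sum_congr rfl fun j _ => this j, ← Finset.sum_filter, Finset.sum_const,
    Finset.filter_ne', Finset.card_erase_of_mem (Finset.mem_univ i), Finset.card_univ,
    Fintype.card_fin]

theorem sum_couple_finset {N : Type*} [AddCommMonoid N] {n : ℕ} (F : Finset (Fin n) → N) :
    ∑ I : Couple n, F {I.1.1, I.1.2} = ∑ s ∈ Finset.powersetCard 2 Finset.univ, F s := by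
  refine Finset.sum_bij (fun I _ => {I.1.1, I.1.2}) ?_ ?_ ?_ fun _ _ => rfl
  · intro I _
    simp [Finset.mem_powersetCard, Finset.card_pair I.2.ne]
  · rintro ⟨⟨i, j⟩, hij⟩ _ ⟨⟨k, l⟩, hkl⟩ _ h
    dsimp only at h hij hkl
    have hi : i = k ∨ i = l := by simpa using (Finset.ext_iff.1 h i).1 (by simp)
    have hj : j = k ∨ j = l := by simpa using (Finset.ext_iff.1 h j).1 (by simp)
    have : i = k ∧ j = l := by lia
    simp [this]
  · intro s hs
    obtain ⟨i, j, hij, rfl⟩ := Finset.card_eq_two.1 (Finset.mem_powersetCard.1 hs).2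
    rcases hij.lt_or_gt with h | h
    · exact ⟨⟨(i, j), h⟩, Finset.mem_univ _, rfl⟩
    · exact ⟨⟨(j, i), h⟩, Finset.mem_univ _, Finset.pair_comm _ _⟩

theorem card_couple (n : ℕ) : Fintype.card (Couple n) = n.choose 2 := by
  have := sum_couple_finset (n := n) (fun _ => 1)
  simpa using this

theorem sum_couple_singleton_add {G : Type*} [AddCommMonoid G] {n : ℕ} (a : Fin n → G) :
    ∑ I : Couple n, ({a I.1.1 + a I.1.2} : Multiset G) = pairSums (Finset.univ.val.map a) := by
  have := sum_couple_finset fun s => ({∑ i ∈ s, a i} : Multiset G)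
  rw [pairSums, Multiset.powersetCard_map, Multiset.map_map, ← Finset.map_val_val_powersetCard,
    Multiset.map_map, ← Multiset.sum_map_singleton (Multiset.map _ _), Multiset.map_map]
  refine Eq.trans (Finset.sum_congr rfl fun I _ => ?_) this
  rw [Finset.sum_pair I.2.ne]

/-! ### Gluing linear forms on hyperplanes -/

/-- A function that is linear on every hyperplane `x i = x j` is linear on their union. -/
theorem exists_linear_of_forall_hyperplane {G : Type*} [Field G] {n : ℕ} (hn : 4 ≤ n)
    (h : (Fin n → G) → G) (φ : Fin n → Fin n → ((Fin n → G) →ₗ[G] G))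
    (hφ : ∀ i j, i < j → ∀ x, x i = x j → h x = φ i j x) :
    ∃ L : (Fin n → G) →ₗ[G] G, ∀ i j, i < j → ∀ x, x i = x j → h x = L x := by
  let e0 : Fin n := ⟨0, by omega⟩
  let e1 : Fin n := ⟨1, by omega⟩
  let e2 : Fin n := ⟨2, by omega⟩
  let e3 : Fin n := ⟨3, by omega⟩
  have h01 : e0 ≠ e1 := by simp [e0, e1]
  have h02 : e0 ≠ e2 := by simp [e0, e2]
  have h03 : e0 ≠ e3 := by simp [e0, e3]
  have h12 : e1 ≠ e2 := by simp [e1, e2]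
  have h13 : e1 ≠ e3 := by simp [e1, e3]
  have h23 : e2 ≠ e3 := by simp [e2, e3]
  have l01 : e0 < e1 := by simp [e0, e1]
  have l02 : e0 < e2 := by simp [e0, e2]
  -- extension to a hyperplane spanned by its intersections with two others
  have ext : ∀ (L : (Fin n → G) →ₗ[G] G) (i j k l k' l' : Fin n), i < j →
      (∀ x, x k = x l → h x = L x) → (∀ x, x k' = x l' → h x = L x) →
      (∃ w : Fin n → G, w i = w j ∧ w k' = w l' ∧ w k ≠ w l) →
      ∀ x, x i = x j → h x = L x := by
    rintro L i j k l k' l' hij hk hk' ⟨w, hw, hw', hwk⟩ x hx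
    have hne : w k - w l ≠ 0 := sub_ne_zero.2 hwk
    -- Chosen so that `x - t • w` lies on the hyperplane `k, l`.
    let t : G := (x k - x l) / (w k - w l)
    have ht : t * (w k - w l) = x k - x l := div_mul_cancel₀ _ hne
    have a1 : φ i j (t • w) = L (t • w) := by
      rw [← hφ i j hij (t • w) (by simp [hw]), hk' (t • w) (by simp [hw'])]
    have a2 : φ i j (x - t • w) = L (x - t • w) := by
      rw [← hφ i j hij _ (by simp [hw, hx]), hk]
      simp only [Pi.sub_apply, Pi.smul_apply, smul_eq_mul]
      linear_combination -ht
    rw [hφ i j hij x hx]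
    rw [map_sub, map_sub] at a2
    linear_combination a2 + a1
  let v : (Fin n → G) →ₗ[G] (Fin n → G) :=
    (LinearMap.single G (fun _ => G) e1).comp
      (LinearMap.proj (R := G) (φ := fun _ => G) e1 - LinearMap.proj e0)
  have hv : ∀ x, v x = Pi.single e1 (x e1 - x e0) := fun x => rfl
  -- `x - v x` lies on the hyperplane `e0, e1` and `v x` on `e0, e2`, so `L` is the only possible
  -- candidate.
  let L : (Fin n → G) →ₗ[G] G := φ e0 e1 ∘ₗ (LinearMap.id - v) + φ e0 e2 ∘ₗ v
  have hL : ∀ x, L x = φ e0 e1 (x - v x) + φ e0 e2 (v x) := fun x => rfl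
  have H01 : ∀ x, x e0 = x e1 → h x = L x := by
    intro x hx
    rw [hL, hv, hx, sub_self, Pi.single_zero, sub_zero, map_zero, add_zero]
    exact hφ _ _ l01 x hx
  have H02 : ∀ x, x e0 = x e2 → h x = L x := by
    intro x hx
    have b : φ e0 e1 (x - v x) = φ e0 e2 (x - v x) := by
      rw [← hφ e0 e1 l01, ← hφ e0 e2 l02]
      · simp [hv, h01, h12.symm, hx]
      · simp [hv, h01]
    rw [hL, b, ← map_add, sub_add_cancel]
    exact hφ _ _ l02 x hx
  have H : ∀ i j, i < j → i ≠ e1 ∨ j ≠ e2 → ∀ x, x i = x j → h x = L x := by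
    intro i j hij hne
    by_cases hi : i = e1
    · subst hi
      have hj2 : j ≠ e2 := by tauto
      have hj0 : j ≠ e0 := (l01.trans hij).ne'
      refine ext L e1 j e0 e1 e0 e2 hij H01 H02 ⟨Pi.single e1 1 + Pi.single j 1, ?_, ?_, ?_⟩
      · simp [hij.ne, hij.ne']
      · simp [h01, hj0.symm, h12.symm, hj2.symm]
      · simp [h01, hj0.symm, hij.ne]
    · by_cases hj : j = e1
      · subst hj
        have : i = e0 := by
          apply Fin.ext
          have : (i : ℕ) < 1 := hij
          change (i : ℕ) = 0
          omega
        subst this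
        exact H01
      · refine ext L i j e0 e1 e0 e2 hij H01 H02 ⟨Pi.single e1 1, ?_, ?_, ?_⟩
        · simp [hi, hj]
        · simp [h01, h12.symm]
        · simp [h01]
  have H03 := H e0 e3 (by simp [e0, e3]) (Or.inl h01)
  refine ⟨L, fun i j hij => ?_⟩
  by_cases hne : i ≠ e1 ∨ j ≠ e2
  · exact H i j hij hne
  · push Not at hne
    obtain ⟨rfl, rfl⟩ := hne
    -- The hyperplanes `e0, e1` and `e0, e2` cut `e1, e2` in the same subspace, so a fourth
    -- coordinate is needed.
    refine ext L e1 e2 e0 e1 e0 e3 hij H01 H03 ⟨Pi.single e1 1 + Pi.single e2 1, ?_, ?_, ?_⟩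
    · simp [h12, h12.symm]
    · simp [h01, h02, h13.symm, h23.symm]
    · simp [h01, h02, h12]

/-! ### Minors of affine functions -/

theorem succAbove_castPred {m : ℕ} (I : Couple (m + 1)) :
    I.1.2.succAbove (I.1.1.castPred (Fin.ne_last_of_lt I.2)) = I.1.1 :=
  Fin.succAbove_castPred_of_lt _ _ I.2

/-- The identification minor recovers `f` on the tuples whose two entries coincide. -/
theorem identMinor_removeNth {A B : Type*} {m : ℕ} (f : NFun A B (m + 1)) (I : Couple (m + 1))
    (x : Fin (m + 1) → A) (hx : x I.1.1 = x I.1.2) :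
    identMinor f I (fun k => x (I.1.2.succAbove k)) = f x := by
  unfold identMinor
  beta_reduce
  rw [succAbove_castPred, hx]
  congr 1
  exact Fin.insertNth_self_removeNth _ _

theorem identMinor_const {A B : Type*} {m : ℕ} (f : NFun A B (m + 1)) (I : Couple (m + 1))
    (t : A) : identMinor f I (fun _ => t) = f (fun _ => t) :=
  identMinor_removeNth f I (fun _ => t) rfl

theorem IsAffine.of_equivalent {G : Type*} [Semiring G] {n : ℕ} {f g : NFun G G n}
    (hf : IsAffine f) (h : Equivalent g f) : IsAffine g := by
  obtain ⟨a, c, hf⟩ := hf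
  obtain ⟨σ, h⟩ := h
  refine ⟨fun i => a (σ.symm i), c, fun x => ?_⟩
  rw [h, hf]
  congr 1
  rw [← Equiv.sum_comp σ fun i => a (σ.symm i) * x i]
  simp

theorem identMinor_affine {G : Type*} [CommSemiring G] {m : ℕ} {f : NFun G G (m + 1)}
    {a : Fin (m + 1) → G} {c : G} (hf : ∀ x, f x = ∑ i, a i * x i + c) (I : Couple (m + 1))
    (x : Fin m → G) :
    identMinor f I x = ∑ k, ((if k = I.1.1.castPred (Fin.ne_last_of_lt I.2) then a I.1.2 else 0)
      + a (I.1.2.succAbove k)) * x k + c := by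
  unfold identMinor
  rw [hf, Fin.sum_univ_succAbove _ I.1.2]
  simp [add_mul, Finset.sum_add_distrib, ite_mul]

theorem IsAffine.identMinor {G : Type*} [CommSemiring G] {m : ℕ} {f : NFun G G (m + 1)}
    (hf : IsAffine f) (I : Couple (m + 1)) : IsAffine (identMinor f I) := by
  obtain ⟨a, c, hf⟩ := hf
  exact ⟨_, c, identMinor_affine hf I⟩

/-- A function of arity greater than the order of a finite field and at least four is affine if
all its identification minors are. -/
theorem isAffine_of_identMinor {G : Type*} [Field G] [Finite G] {m : ℕ} (hm : 4 ≤ m + 1)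
    (hq : Nat.card G < m + 1) (g : NFun G G (m + 1)) (hg : ∀ I, IsAffine (identMinor g I)) :
    IsAffine g := by
  choose a c hac using hg
  have hc : ∀ I, c I = g 0 := by
    intro I
    have h1 := identMinor_const g I 0
    rw [hac] at h1
    simp only [mul_zero, Finset.sum_const_zero, zero_add] at h1
    exact h1
  obtain ⟨L, hL⟩ := exists_linear_of_forall_hyperplane hm (fun x => g x - g 0)
    (fun i j => if hij : i < j then
      (∑ k, a ⟨(i, j), hij⟩ k • LinearMap.proj (j.succAbove k)) else 0) (by
      intro i j hij x hx
      have h1 := identMinor_removeNth g ⟨(i, j), hij⟩ x hx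
      rw [hac, hc] at h1
      simp only [hij, dite_true, ← h1, add_sub_cancel_right, LinearMap.sum_apply,
        LinearMap.smul_apply, LinearMap.proj_apply, smul_eq_mul])
  refine ⟨fun i => L (Pi.single i 1), g 0, fun x => ?_⟩
  have hx : g x - g 0 = L x := by
    have := Fintype.ofFinite G
    obtain ⟨i, j, hij, hx⟩ := Fintype.exists_ne_map_eq_of_card_lt x
      (by rwa [Fintype.card_fin, ← Nat.card_eq_fintype_card])
    rcases hij.lt_or_gt with h | h
    · exact hL i j h x hx
    · exact hL j i h x hx.symm
  rw [← sub_eq_iff_eq_add, hx, LinearMap.pi_apply_eq_sum_univ L x]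
  refine Finset.sum_congr rfl fun i _ => ?_
  rw [smul_eq_mul, mul_comm]
  congr 2
  ext j
  simp [Pi.single_apply, eq_comm]

/-! ### Coefficient multisets and the deck -/

/-- The multiset of the values `f eᵢ - f 0`: for an affine function, its coefficients. -/
def coeffs {G : Type*} [Ring G] {n : ℕ} (f : NFun G G n) : Multiset G :=
  ∑ i, {f (Pi.single i 1) - f 0}

theorem coeffs_eq_of_equivalent {G : Type*} [Ring G] {n : ℕ} {f g : NFun G G n}
    (h : Equivalent f g) : coeffs f = coeffs g := by
  obtain ⟨σ, h⟩ := h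
  unfold coeffs
  rw [← Equiv.sum_comp σ]
  refine Finset.sum_congr rfl fun i _ => ?_
  rw [h, h 0]
  congr 3
  ext j
  simp [Pi.single_apply]

theorem coeffs_affine {G : Type*} [Ring G] {n : ℕ} {f : NFun G G n}
    {a : Fin n → G} {c : G} (hf : ∀ x, f x = ∑ i, a i * x i + c) :
    coeffs f = Finset.univ.val.map a := by
  rw [← Multiset.sum_map_singleton (Multiset.map _ _), Multiset.map_map]
  refine Finset.sum_congr rfl fun i _ => ?_
  simp [hf, Pi.single_apply]

/-- Identification merges two coefficients into their sum; the additive form avoids truncated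
subtraction of multisets. -/
theorem coeffs_identMinor_add {G : Type*} [CommRing G] {m : ℕ} {f : NFun G G (m + 1)}
    {a : Fin (m + 1) → G} {c : G} (hf : ∀ x, f x = ∑ i, a i * x i + c) (I : Couple (m + 1)) :
    coeffs (identMinor f I) + ({a I.1.1} + {a I.1.2}) = coeffs f + {a I.1.1 + a I.1.2} := by
  have e : ∀ {k : ℕ} (b : Fin k → G), Finset.univ.val.map b = ∑ i, {b i} := by
    intro k b
    rw [← Multiset.sum_map_singleton (Multiset.map _ _), Multiset.map_map]
    rfl
  rw [coeffs_affine hf, coeffs_affine (identMinor_affine hf I), e, e,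
    Fin.sum_univ_succAbove _ I.1.2]
  set p := I.1.1.castPred (Fin.ne_last_of_lt I.2) with hp
  have hI : I.1.2.succAbove p = I.1.1 := succAbove_castPred I
  rw [← Finset.add_sum_erase _ _ (Finset.mem_univ p), ← Finset.add_sum_erase
    (f := fun k => ({a (I.1.2.succAbove k)} : Multiset G)) _ (Finset.mem_univ p)]
  have : ∑ k ∈ Finset.univ.erase p,
      ({(if k = p then a I.1.2 else 0) + a (I.1.2.succAbove k)} : Multiset G) =
      ∑ k ∈ Finset.univ.erase p, {a (I.1.2.succAbove k)} := by
    refine Finset.sum_congr rfl fun k hk => ?_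
    rw [if_neg (Finset.ne_of_mem_erase hk), zero_add]
  rw [this, if_pos rfl, hI, add_comm (a I.1.2)]
  abel

theorem sum_coeffs_identMinor_add {G : Type*} [CommRing G] {m : ℕ} {f : NFun G G (m + 1)}
    (hf : IsAffine f) :
    ∑ I, coeffs (identMinor f I) + m • coeffs f =
      (m + 1).choose 2 • coeffs f + pairSums (coeffs f) := by
  obtain ⟨a, c, hf⟩ := hf
  have h1 : ∑ I : Couple (m + 1), (({a I.1.1} : Multiset G) + {a I.1.2}) = m • coeffs f := by
    rw [sum_couple_add fun i => ({a i} : Multiset G), coeffs_affine hf,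
      ← Multiset.sum_map_singleton (Multiset.map _ _), Multiset.map_map]
    rfl
  rw [← h1, ← Finset.sum_add_distrib, Finset.sum_congr rfl fun I _ => coeffs_identMinor_add hf I,
    Finset.sum_add_distrib, sum_couple_singleton_add, ← coeffs_affine hf, Finset.sum_const,
    Finset.card_univ, card_couple]

theorem sum_coeffs_identMinor {G : Type*} [CommRing G] {m : ℕ} {f : NFun G G (m + 1)}
    (hf : IsAffine f) :
    ∑ I, coeffs (identMinor f I) = m.choose 2 • coeffs f + pairSums (coeffs f) := by
  apply add_right_cancel (b := m • coeffs f)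
  rw [sum_coeffs_identMinor_add hf, Nat.choose_succ_succ' m 1, Nat.choose_one_right, add_nsmul]
  abel

theorem sum_coeffs_identMinor_eq_of_deck_eq {G : Type*} [Ring G] {m : ℕ}
    {f g : NFun G G (m + 1)} (h : deck f = deck g) :
    ∑ I, coeffs (identMinor f I) = ∑ I, coeffs (identMinor g I) := by
  let T : Quotient (equivSetoid G G m) → Multiset G :=
    Quotient.lift coeffs fun _ _ => coeffs_eq_of_equivalent
  have hT : ∀ k : NFun G G (m + 1), ∑ I, coeffs (identMinor k I) = ((deck k).map T).sum := by
    intro k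
    rw [deck, Multiset.map_map]
    rfl
  rw [hT, hT, h]

theorem exists_equivalent_of_deck_eq {A B : Type*} {m : ℕ} {f g : NFun A B (m + 1)}
    (h : deck f = deck g) (I : Couple (m + 1)) :
    ∃ J, Equivalent (identMinor g I) (identMinor f J) := by
  have hI : Quotient.mk (equivSetoid A B m) (identMinor g I) ∈ deck f := by
    rw [h]
    exact Multiset.mem_map_of_mem _ (Finset.mem_univ I)
  obtain ⟨J, -, hJ⟩ := Multiset.mem_map.1 hI
  exact ⟨J, Quotient.exact hJ.symm⟩

/-- Neither identification nor permutation of arguments affects values at constant tuples, so a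
single minor suffices. -/
theorem apply_const_eq_of_deck_eq {A B : Type*} {m : ℕ} (hm : 1 ≤ m) {f g : NFun A B (m + 1)}
    (h : deck f = deck g) (t : A) : f (fun _ => t) = g (fun _ => t) := by
  obtain ⟨J, σ, hJ⟩ := exists_equivalent_of_deck_eq h
    ⟨(0, Fin.last m), Fin.lt_def.2 (by simpa using Nat.pos_of_ne_zero (by omega))⟩
  have := hJ fun _ => t
  rw [identMinor_const, identMinor_const] at this
  exact this.symm

theorem exists_perm_of_map_univ_eq {ι G : Type*} [Fintype ι] {a b : ι → G}
    (h : Finset.univ.val.map a = Finset.univ.val.map b) :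
    ∃ σ : Equiv.Perm ι, ∀ i, b (σ i) = a i := by
  classical
  have e : ∀ c, Nonempty ({i // a i = c} ≃ {i // b i = c}) := by
    intro c
    rw [← Fintype.card_eq, Fintype.card_subtype, Fintype.card_subtype]
    have := congrArg (Multiset.count c) h
    rw [Multiset.count_map, Multiset.count_map] at this
    simp only [eq_comm (a := c)] at this
    exact this
  exact ⟨Equiv.ofFiberEquiv fun c => (e c).some, Equiv.ofFiberEquiv_map _⟩

theorem equivalent_of_isAffine_of_deck_eq {G : Type*} [CommRing G] {m : ℕ} (hm : 4 ≤ m + 1)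
    {f g : NFun G G (m + 1)} (hf : IsAffine f) (hg : IsAffine g) (h : deck f = deck g) :
    Equivalent f g := by
  have hT := sum_coeffs_identMinor_eq_of_deck_eq h
  rw [sum_coeffs_identMinor hf, sum_coeffs_identMinor hg] at hT
  have h0 := apply_const_eq_of_deck_eq (by omega) h 0
  have h1 := apply_const_eq_of_deck_eq (by omega) h 1
  obtain ⟨a, c, hf⟩ := hf
  obtain ⟨b, d, hg⟩ := hg
  rw [coeffs_affine hf, coeffs_affine hg] at hT
  simp only [hf, hg, mul_zero, mul_one, Finset.sum_const_zero, zero_add] at h0 h1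
  subst h0
  have hM := eq_of_nsmul_add_pairSums_eq (M := Finset.univ.val.map a)
    (M' := Finset.univ.val.map b) (by simpa using hm) (by simp) (add_right_cancel h1)
    (by simpa using hT)
  obtain ⟨σ, hσ⟩ := exists_perm_of_map_univ_eq hM
  refine ⟨σ.symm, fun x => ?_⟩
  rw [hf, hg, ← Equiv.sum_comp σ fun i => b i * x (σ.symm i)]
  simp [hσ]

end FunRec

theorem mainTheorem6 {G : Type*} [Field G] [Finite G] :
    FunRec.ReconstructibleClass
      {f : FunRec.SomeFun G G |
        FunRec.IsAffine f.2 ∧ max (Nat.card G) 3 + 1 ≤ FunRec.SomeFun.arity f} := by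
  rintro ⟨m, f⟩ ⟨hf, hn⟩ g hg
  unfold FunRec.SomeFun.arity at hn
  dsimp only at f hf hn g hg ⊢
  refine FunRec.equivalent_of_isAffine_of_deck_eq (by omega) hf ?_ hg
  refine FunRec.isAffine_of_identMinor (by omega) (by omega) g fun I => ?_
  obtain ⟨J, hJ⟩ := FunRec.exists_equivalent_of_deck_eq hg I
  exact (hf.identMinor J).of_equivalent hJ
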